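/- For a matroid $M$ on a finite ground set $E$, an automorphism of $M$ is a bijection $\varphi\colon E\to E$ such that $\varphi(C)$ is a circuit if and only if $C$ is a circuit; a set $S\subseteq E$ is a fixing set if the identity is the only automorphism of $M$ that fixes every element of $S$; and $\mathrm{fix}(M)$ is the minimum size of a fixing set. For a finite graph $G$ (loops and parallel edges are allowed), the cycle matroid $M(G)$ is the matroid on the edge set of $G$ whose circuits are the edge sets of the cycles of $G$. Let $G$ be a finite planar graph, not necessarily connected, and let $G^*$ be the dual graph of $G$ with respect to any embedding of $G$ in the plane: the vertices of $G^*$ are the faces of the embedding, and each edge $e$ of $G$ gives one edge of $G^*$, which joins the faces on the two sides of $e$ and is identified with $e$. (Embeddings in the plane are described combinatorially: by the cyclic order of the edge ends around each vertex and by the face on each side of each edge, where the face stays the same along each boundary walk, the faces are connected to each other across edges, and Euler's formula $|V|-|E|+|F|=1+c$ holds, $c$ being the number of connected components of $G$.) Then $$\mathrm{fix}(M(G))=\mathrm{fix}(M(G^*)).$$ -/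

import Mathlib

/-! ## Fixing number of a matroid -/

namespace Matroid

variable {β : Type*}

/-- A bijection of the ground set is an automorphism of `M` if it preserves circuits in both
directions. -/
def IsAutomorphism (M : Matroid β) (φ : Equiv.Perm M.E) : Prop :=
  ∀ C : Set M.E, M.IsCircuit (Subtype.val '' (φ '' C)) ↔ M.IsCircuit (Subtype.val '' C)

/-- A set `S` of elements is a fixing set if the only automorphism that fixes `S` pointwise is
the identity. -/
def IsFixingSet (M : Matroid β) (S : Set M.E) : Prop :=
  ∀ φ : Equiv.Perm M.E, M.IsAutomorphism φ → (∀ x ∈ S, φ x = x) → φ = 1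

/-- The fixing number: the least `r` such that `M` has an `r`-element fixing set. -/
noncomputable def fixingNumber (M : Matroid β) : ℕ :=
  sInf {r : ℕ | ∃ S : Finset M.E, S.card = r ∧ M.IsFixingSet (S : Set M.E)}

/-- For a matroid on a finite ground set the minimum defining the fixing number is attained. -/
theorem exists_fixingSet_card_eq_fixingNumber (M : Matroid β) (hM : M.E.Finite) :
    ∃ S : Finset M.E, S.card = M.fixingNumber ∧ M.IsFixingSet (S : Set M.E) := by
  have : Fintype M.E := hM.fintype
  refine Nat.sInf_mem (s := {r : ℕ | ∃ S : Finset M.E, S.card = r ∧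
    M.IsFixingSet (S : Set M.E)}) ⟨_, Finset.univ, rfl, fun φ _ h ↦ ?_⟩
  ext x
  simp [h x (by simp)]

end Matroid

/-! ## Cycle matroid of a multigraph -/

namespace Graph

variable {α β : Type*}

/-- `C` is the edge set of a cycle of `G`: there are `k + 1` distinct vertices `v 0, …, v k` and
`k + 1` distinct edges `e 0, …, e k` with `e i` joining `v i` to `v (i + 1)`, indices modulo
`k + 1`.  A loop is a cycle (`k = 0`), and so is a pair of parallel edges (`k = 1`). -/
def IsCycleSet (G : Graph α β) (C : Set β) : Prop :=
  ∃ (k : ℕ) (v : Fin (k + 1) → α) (e : Fin (k + 1) → β),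
    Function.Injective v ∧ Function.Injective e ∧
    (∀ i, G.IsLink (e i) (v i) (v (i + 1))) ∧ C = Set.range e

/-- A set of edges that contains no cycle of `G`. -/
def IsAcyclicSet (G : Graph α β) (I : Set β) : Prop :=
  I ⊆ E(G) ∧ ∀ C, C ⊆ I → ¬ G.IsCycleSet C

open Classical in
/-- The row of the mod 2 incidence matrix of `G` that belongs to the edge `e`.  (Auxiliary: used
to check the matroid axioms for acyclic edge sets.) -/
noncomputable def incVec (G : Graph α β) (e : β) : α → ZMod 2 :=
  fun x ↦ if G.IsNonloopAt e x then 1 else 0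

open Classical in
theorem IsLink.incVec_eq {G : Graph α β} {e : β} {x y : α} (h : G.IsLink e x y) :
    G.incVec e = Pi.single x 1 + Pi.single y 1 := by
  funext z
  have hiff : G.IsNonloopAt e z ↔ x ≠ y ∧ (z = x ∨ z = y) := by
    simp only [IsNonloopAt, h.isLink_iff]
    constructor
    · rintro ⟨w, hw, h1 | h1⟩ <;> grind
    · rintro ⟨hxy, rfl | rfl⟩
      · exact ⟨y, by grind⟩
      · exact ⟨x, by grind⟩
  simp only [incVec, hiff, Pi.add_apply, Pi.single_apply]
  by_cases hxy : x = y
  · subst hxy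
    rw [if_neg (by simp)]
    exact (CharTwo.add_self_eq_zero _).symm
  · by_cases hzx : z = x
    · subst hzx; simp [hxy]
    · simp [hzx, hxy]

theorem IsCycleSet.subset_edgeSet {G : Graph α β} {C : Set β} (hC : G.IsCycleSet C) :
    C ⊆ E(G) := by
  obtain ⟨k, v, e, -, -, hl, rfl⟩ := hC
  rintro _ ⟨i, rfl⟩
  exact (hl i).edge_mem

theorem IsCycleSet.nonempty {G : Graph α β} {C : Set β} (hC : G.IsCycleSet C) :
    C.Nonempty := by
  obtain ⟨k, v, e, -, -, hl, rfl⟩ := hC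
  exact ⟨e 0, 0, rfl⟩

theorem IsCycleSet.finite {G : Graph α β} {C : Set β} (hC : G.IsCycleSet C) : C.Finite := by
  obtain ⟨k, v, e, -, -, hl, rfl⟩ := hC
  exact Set.finite_range e

/-- The incidence vectors along a cycle add up to zero. -/
theorem IsCycleSet.sum_incVec {G : Graph α β} {T : Finset β} (hC : G.IsCycleSet (T : Set β)) :
    ∑ e ∈ T, G.incVec e = 0 := by
  classical
  obtain ⟨k, v, e, -, he, hl, hT⟩ := hC
  have : T = Finset.univ.image e := by
    apply Finset.coe_injective; simp [hT]
  rw [this, Finset.sum_image (fun _ _ _ _ h ↦ he h)]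
  simp only [fun i ↦ (hl i).incVec_eq, Finset.sum_add_distrib]
  have h2 : ∑ i, (Pi.single (v (i + 1)) 1 : α → ZMod 2) = ∑ i, Pi.single (v i) 1 :=
    Equiv.sum_comp (Equiv.addRight (1 : Fin (k + 1))) (fun i ↦ (Pi.single (v i) 1 : α → ZMod 2))
  rw [h2]
  funext z
  exact CharTwo.add_self_eq_zero _

/-- A nonempty edge set inside a cycle whose incidence vectors add up to zero is the cycle. -/
theorem IsCycleSet.eq_of_sum_incVec {G : Graph α β} {C : Set β} (hC : G.IsCycleSet C)
    {T : Finset β} (hTC : (T : Set β) ⊆ C) (hT : T.Nonempty) (h0 : ∑ e ∈ T, G.incVec e = 0) :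
    (T : Set β) = C := by
  classical
  obtain ⟨k, v, e, hv, he, hl, rfl⟩ := hC
  have hstep : ∀ i, e i ∈ T ↔ e (i + 1) ∈ T := by
    intro i
    have hT' : T = (Finset.univ.filter (fun j ↦ e j ∈ T)).image e := by
      ext x
      simp only [Finset.mem_image, Finset.mem_filter, Finset.mem_univ, true_and]
      constructor
      · intro hx
        obtain ⟨j, rfl⟩ := hTC hx
        exact ⟨j, hx, rfl⟩
      · rintro ⟨j, hj, rfl⟩; exact hj
    have h1 : ∑ j, (if e j ∈ T then G.incVec (e j) (v (i + 1)) else 0) = 0 := by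
      have := congrFun h0 (v (i + 1))
      rw [hT', Finset.sum_image (fun _ _ _ _ h ↦ he h), Finset.sum_filter] at this
      rw [Finset.sum_apply] at this
      refine Eq.trans ?_ this
      exact Finset.sum_congr rfl fun j _ ↦ by split_ifs <;> rfl
    have h2 : ∀ j, (if e j ∈ T then G.incVec (e j) (v (i + 1)) else 0) =
        (if j = i + 1 then (if e (i + 1) ∈ T then 1 else 0) else 0) +
        (if j = i then (if e i ∈ T then 1 else 0) else (0 : ZMod 2)) := by
      intro j
      rw [(hl j).incVec_eq]
      simp only [Pi.add_apply, Pi.single_apply, hv.eq_iff, add_left_inj]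
      have h6 : (i + 1 = j) = (j = i + 1) := propext eq_comm
      have h7 : (i = j) = (j = i) := propext eq_comm
      simp only [h6, h7]
      by_cases h3 : j = i + 1
      · by_cases h4 : j = i
        · rw [← h3, ← h4]; by_cases h5 : e j ∈ T <;> simp [h5]
        · rw [← h3]; by_cases h5 : e j ∈ T <;> simp [h5, h4]
      · by_cases h4 : j = i
        · subst h4; by_cases h5 : e j ∈ T <;> simp [h5, h3]
        · simp [h3, h4]
    simp only [h2, Finset.sum_add_distrib, Finset.sum_ite_eq', Finset.mem_univ, if_true] at h1
    by_cases h3 : e i ∈ T <;> by_cases h4 : e (i + 1) ∈ T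
    · exact iff_of_true h3 h4
    · simp [h3, h4] at h1
    · simp [h3, h4] at h1
    · exact iff_of_false h3 h4
  have hall : ∀ (n : ℕ) (i : Fin (k + 1)), e i ∈ T → e (i + Fin.ofNat (k + 1) n) ∈ T := by
    intro n
    induction n with
    | zero => intro i hi; simpa using hi
    | succ n ih =>
      intro i hi
      have := (hstep _).1 (ih i hi)
      rw [add_assoc] at this
      convert this using 3
      ext
      simp [Fin.val_add]
  refine Set.Subset.antisymm hTC ?_
  rintro _ ⟨j, rfl⟩
  obtain ⟨x, hx⟩ := hT
  obtain ⟨i, rfl⟩ := hTC hx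
  have := hall (j - i).val i hx
  rw [Fin.ofNat_val_eq_self] at this
  simpa using this

/-- A nonempty finite edge set whose incidence vectors add up to zero contains a cycle. -/
theorem exists_isCycleSet_of_sum_incVec {G : Graph α β} {T : Finset β}
    (hTE : (T : Set β) ⊆ E(G)) (hT : T.Nonempty) (h0 : ∑ e ∈ T, G.incVec e = 0) :
    ∃ C, C ⊆ (T : Set β) ∧ G.IsCycleSet C := by
  classical
  by_cases hloop : ∃ e ∈ T, ∃ x, G.IsLink e x x
  · obtain ⟨e, he, x, hx⟩ := hloop
    refine ⟨{e}, by simpa using he, 0, fun _ ↦ x, fun _ ↦ e, ?_, ?_, fun _ ↦ hx, by simp⟩ <;>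
    exact fun a b _ ↦ Fin.ext (by omega)
  push Not at hloop
  -- an edge at `x` can be continued by another edge at `x`
  have hnext : ∀ p : {p : β × α // p.1 ∈ T ∧ G.Inc p.1 p.2},
      ∃ q : {p : β × α // p.1 ∈ T ∧ G.Inc p.1 p.2},
        q.1.1 ≠ p.1.1 ∧ G.IsLink q.1.1 p.1.2 q.1.2 := by
    rintro ⟨⟨e, x⟩, he, y, hxy⟩
    simp only at he hxy
    have hyx : y ≠ x := by rintro rfl; exact hloop e he _ hxy
    by_contra! hcon
    have hother : ∀ e' ∈ T, e' ≠ e → G.incVec e' x = 0 := by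
      intro e' he' hne
      simp only [incVec, ite_eq_right_iff, one_ne_zero, imp_false]
      rintro ⟨z, hz, hl⟩
      exact hcon ⟨⟨e', z⟩, he', x, hl.symm⟩ hne hl
    have h1 := congrFun h0 x
    rw [Finset.sum_apply, Finset.sum_eq_single_of_mem e he hother] at h1
    simp only [incVec, Pi.zero_apply, ite_eq_right_iff, one_ne_zero, imp_false] at h1
    exact h1 ⟨y, hyx, hxy⟩
  choose nx hnx using hnext
  obtain ⟨e₀, he₀⟩ := hT
  obtain ⟨x₀, y₀, hl₀⟩ := G.exists_isLink_of_mem_edgeSet (hTE he₀)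
  let p : ℕ → {p : β × α // p.1 ∈ T ∧ G.Inc p.1 p.2} :=
    fun n ↦ nx^[n] ⟨⟨e₀, x₀⟩, he₀, y₀, hl₀⟩
  have hp : ∀ n, p (n + 1) = nx (p n) := fun n ↦ Function.iterate_succ_apply' _ _ _
  let w : ℕ → α := fun n ↦ (p n).1.2
  let f : ℕ → β := fun n ↦ (p n).1.1
  have hfT : ∀ n, f n ∈ T := fun n ↦ (p n).2.1
  have hlink : ∀ n, G.IsLink (f (n + 1)) (w n) (w (n + 1)) := by
    intro n; simp only [f, w, hp]; exact (hnx (p n)).2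
  have hne : ∀ n, f (n + 1) ≠ f n := by
    intro n; simp only [f, hp]; exact (hnx (p n)).1
  have hfin : (Set.range w).Finite := by
    have : (⋃ e ∈ T, {x | G.Inc e x}).Finite := by
      refine T.finite_toSet.biUnion fun e he ↦ ?_
      obtain ⟨x, y, hxy⟩ := G.exists_isLink_of_mem_edgeSet (hTE he)
      exact (Set.toFinite {x, y}).subset fun z hz ↦ hz.eq_or_eq_of_isLink hxy
    refine this.subset ?_
    rintro _ ⟨n, rfl⟩
    simp only [Set.mem_iUnion]
    exact ⟨f n, hfT n, (p n).2.2⟩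
  have hrep : ∃ j, ∃ i < j, w i = w j := by
    have hni : ¬ Function.Injective w := fun h ↦ Set.infinite_range_of_injective h hfin
    simp only [Function.Injective, not_forall] at hni
    obtain ⟨a, b, hab, hne⟩ := hni
    rcases lt_or_gt_of_ne hne with h | h
    · exact ⟨b, a, h, hab⟩
    · exact ⟨a, b, h, hab.symm⟩
  obtain ⟨i, hij, hw⟩ := Nat.find_spec hrep
  have hmin : ∀ a b, a < b → b < Nat.find hrep → w a ≠ w b :=
    fun a b hab hb h ↦ Nat.find_min hrep hb ⟨a, hab, h⟩
  set j := Nat.find hrep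
  obtain ⟨k, hk⟩ : ∃ k, j = i + (k + 1) := ⟨j - i - 1, by omega⟩
  have hinj : ∀ a b, a < j → b < j → w a = w b → a = b := by
    intro a b ha hb h
    rcases lt_trichotomy a b with h1 | h1 | h1
    · exact absurd h (hmin _ _ h1 hb)
    · exact h1
    · exact absurd h.symm (hmin _ _ h1 ha)
  have hfinj : ∀ s t, s < t → t < k + 1 → f (i + s + 1) ≠ f (i + t + 1) := by
    intro s t hst ht h
    have h1 := hlink (i + s)
    rw [h] at h1
    rcases h1.eq_and_eq_or_eq_and_eq (hlink (i + t)) with ⟨h2, -⟩ | ⟨-, h2⟩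
    · have := hinj _ _ (by omega) (by omega) h2
      omega
    · have := hinj _ _ (by omega) (by omega) h2
      have h3 : i + t + 1 = (i + s + 1) + 1 := by omega
      rw [h3] at h
      exact hne _ h.symm
  refine ⟨Set.range (fun t : Fin (k + 1) ↦ f (i + t + 1)), ?_, k, fun t ↦ w (i + t),
    fun t ↦ f (i + t + 1), ?_, ?_, ?_, rfl⟩
  · rintro _ ⟨t, rfl⟩
    exact hfT _
  · intro s t h
    have := hinj _ _ (by omega) (by omega) h
    ext; omega
  · intro s t h
    rcases lt_trichotomy s.val t.val with h1 | h1 | h1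
    · exact absurd h (hfinj _ _ h1 t.2)
    · exact Fin.ext h1
    · exact absurd h.symm (hfinj _ _ h1 s.2)
  · intro t
    have h1 := hlink (i + t)
    by_cases ht : t = Fin.last k
    · subst ht
      simp only [Fin.last_add_one, Fin.val_zero, Fin.val_last, add_zero] at h1 ⊢
      rw [hw, hk]
      exact h1
    · have : ((t + 1 : Fin (k + 1)) : ℕ) = t + 1 :=
        Fin.val_add_one_of_lt (Fin.lt_last_iff_ne_last.2 ht)
      simp only [this]
      exact h1

theorem not_linearIndepOn_incVec_iff {G : Graph α β} {I : Set β} :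
    ¬ LinearIndepOn (ZMod 2) G.incVec I ↔
      ∃ T : Finset β, (T : Set β) ⊆ I ∧ T.Nonempty ∧ ∑ e ∈ T, G.incVec e = 0 := by
  classical
  rw [linearDepOn_iff]
  constructor
  · rintro ⟨c, hc, hsum, hne⟩
    refine ⟨c.support, hc, Finsupp.support_nonempty_iff.2 hne, ?_⟩
    rw [← hsum]
    refine Finset.sum_congr rfl fun e he ↦ ?_
    have h1 : ∀ z : ZMod 2, z ≠ 0 → z = 1 := by decide
    rw [h1 _ (Finsupp.mem_support_iff.1 he), one_smul]
  · rintro ⟨T, hTI, hT, hsum⟩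
    refine ⟨Finsupp.onFinset T (fun e ↦ if e ∈ T then 1 else 0) (by simp), ?_, ?_, ?_⟩
    · rw [Finsupp.mem_supported]
      exact subset_trans (by simp) hTI
    · have : (Finsupp.onFinset T (fun e ↦ if e ∈ T then (1 : ZMod 2) else 0) (by simp)).support
          = T := by
        ext e; simp
      rw [this, ← hsum]
      exact Finset.sum_congr rfl fun e he ↦ by simp [he]
    · obtain ⟨e, he⟩ := hT
      intro h
      simpa [he] using DFunLike.congr_fun h e

theorem isAcyclicSet_iff_linearIndepOn {G : Graph α β} {I : Set β} (hI : I ⊆ E(G)) :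
    G.IsAcyclicSet I ↔ LinearIndepOn (ZMod 2) G.incVec I := by
  rw [← not_iff_not, not_linearIndepOn_incVec_iff]
  simp only [IsAcyclicSet, hI, true_and, not_forall, not_not]
  constructor
  · rintro ⟨C, hCI, hC⟩
    have hfin := hC.finite
    have hcoe : ((hfin.toFinset : Finset β) : Set β) = C := hfin.coe_toFinset
    refine ⟨hfin.toFinset, by rwa [hcoe], by simpa using hC.nonempty, ?_⟩
    exact IsCycleSet.sum_incVec (by rwa [hcoe])
  · rintro ⟨T, hTI, hT, hsum⟩
    obtain ⟨C, hCT, hC⟩ := exists_isCycleSet_of_sum_incVec (hTI.trans hI) hT hsum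
    exact ⟨C, hCT.trans hTI, hC⟩

theorem IsAcyclicSet.subset {G : Graph α β} {I J : Set β} (hJ : G.IsAcyclicSet J) (h : I ⊆ J) :
    G.IsAcyclicSet I :=
  ⟨h.trans hJ.1, fun C hC ↦ hJ.2 C (hC.trans h)⟩

theorem IsAcyclicSet.exists_insert {G : Graph α β} {I J : Set β} (hI : G.IsAcyclicSet I)
    (hIfin : I.Finite) (hJ : G.IsAcyclicSet J) (hJfin : J.Finite) (hlt : I.ncard < J.ncard) :
    ∃ e ∈ J, e ∉ I ∧ G.IsAcyclicSet (insert e I) := by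
  by_contra! hcon
  have hI' := (isAcyclicSet_iff_linearIndepOn hI.1).1 hI
  have hJ' := (isAcyclicSet_iff_linearIndepOn hJ.1).1 hJ
  have hspan : ∀ e ∈ J, G.incVec e ∈ Submodule.span (ZMod 2) (G.incVec '' I) := by
    intro e he
    by_cases heI : e ∈ I
    · exact Submodule.subset_span ⟨e, heI, rfl⟩
    by_contra hns
    refine hcon e he heI ((isAcyclicSet_iff_linearIndepOn
      (Set.insert_subset (hJ.1 he) hI.1)).2 (hI'.insert hns))
  have : Fintype I := hIfin.fintype
  have : Fintype J := hJfin.fintype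
  have hle : Submodule.span (ZMod 2) (Set.range fun e : J ↦ G.incVec e) ≤
      Submodule.span (ZMod 2) (Set.range fun e : I ↦ G.incVec e) := by
    rw [Submodule.span_le]
    rintro _ ⟨e, rfl⟩
    have := hspan e e.2
    rwa [Set.image_eq_range] at this
  have hfd : Module.Finite (ZMod 2)
      (Submodule.span (ZMod 2) (Set.range fun e : I ↦ G.incVec e)) :=
    FiniteDimensional.span_of_finite _ (Set.finite_range _)
  have h1 := Submodule.finrank_mono hle
  rw [finrank_span_eq_card hI', finrank_span_eq_card hJ'] at h1
  rw [← Nat.card_coe_set_eq, ← Nat.card_coe_set_eq, Nat.card_eq_fintype_card,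
    Nat.card_eq_fintype_card] at hlt
  omega

/-- The cycle matroid of `G`: the matroid on the edge set of `G` whose independent sets are the
sets of edges that contain no cycle of `G`.  Its circuits are the cycles of `G`, see
`Graph.cycleMatroid_isCircuit_iff`. -/
def cycleMatroid (G : Graph α β) : Matroid β :=
  (IndepMatroid.ofFinitaryCardAugment E(G) G.IsAcyclicSet
    ⟨Set.empty_subset _, fun _ hC h ↦ h.nonempty.ne_empty (Set.subset_empty_iff.1 hC)⟩
    (fun _ _ hJ h ↦ hJ.subset h)
    (fun _ _ hI hIfin hJ hJfin hlt ↦ hI.exists_insert hIfin hJ hJfin hlt)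
    (fun _ h ↦ ⟨fun e he ↦ (h {e} (by simpa using he) (Set.finite_singleton e)).1 rfl,
      fun C hC h' ↦ (h C hC h'.finite).2 C subset_rfl h'⟩)
    (fun _ h ↦ h.1)).matroid

@[simp] theorem cycleMatroid_E (G : Graph α β) : G.cycleMatroid.E = E(G) := rfl

@[simp] theorem cycleMatroid_indep_iff {G : Graph α β} {I : Set β} :
    G.cycleMatroid.Indep I ↔ G.IsAcyclicSet I := Iff.rfl

/-- The circuits of the cycle matroid of `G` are exactly the cycles of `G`. -/
theorem cycleMatroid_isCircuit_iff {G : Graph α β} {C : Set β} :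
    G.cycleMatroid.IsCircuit C ↔ G.IsCycleSet C := by
  have hdep : ∀ {D : Set β}, G.cycleMatroid.Dep D ↔
      D ⊆ E(G) ∧ ∃ C, C ⊆ D ∧ G.IsCycleSet C := by
    intro D
    simp only [Matroid.Dep, cycleMatroid_indep_iff, cycleMatroid_E, IsAcyclicSet, not_and,
      not_forall, not_not]
    grind
  rw [Matroid.isCircuit_iff]
  constructor
  · rintro ⟨hC, hmin⟩
    obtain ⟨-, C', hC'C, hC'⟩ := hdep.1 hC
    rwa [← hmin (hdep.2 ⟨hC'.subset_edgeSet, C', subset_rfl, hC'⟩) hC'C]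
  · intro hC
    refine ⟨hdep.2 ⟨hC.subset_edgeSet, C, subset_rfl, hC⟩, fun D hD hDC ↦ ?_⟩
    obtain ⟨-, C', hC'D, hC'⟩ := hdep.1 hD
    have hcoe : ((hC'.finite.toFinset : Finset β) : Set β) = C' := hC'.finite.coe_toFinset
    have := hC.eq_of_sum_incVec (T := hC'.finite.toFinset) (by rw [hcoe]; exact hC'D.trans hDC)
      (by simpa using hC'.nonempty) (IsCycleSet.sum_incVec (by rwa [hcoe]))
    rw [hcoe] at this
    exact hDC.antisymm (this ▸ hC'D)

/-! ## Embeddings in the plane and dual graphs -/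

/-- The number of connected components of `G`. -/
noncomputable def numComponents (G : Graph α β) : ℕ :=
  Nat.card (Quot fun x y : V(G) ↦ G.Adj x y)

/-- The graph with vertex set `F` in which the edge `e` of `E` joins `end e false` to
`end e true`. -/
def ofEnds {F : Type*} (E : Set β) (ends : E × Bool → F) : Graph F β where
  vertexSet := Set.univ
  edgeSet := E
  IsLink e f g := ∃ (he : e ∈ E) (b : Bool), ends (⟨e, he⟩, b) = f ∧ ends (⟨e, he⟩, !b) = g
  isLink_symm e _ := ⟨fun f g ⟨he, b, hf, hg⟩ ↦ ⟨he, !b, hg, by simpa using hf⟩⟩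
  eq_or_eq_of_isLink_of_isLink := by
    rintro e x y v w ⟨he, b, rfl, rfl⟩ ⟨-, c, rfl, rfl⟩
    cases b <;> cases c <;> simp
  edge_mem_iff_exists_isLink e :=
    ⟨fun he ↦ ⟨_, _, he, false, rfl, rfl⟩, fun ⟨_, _, he, _⟩ ↦ he⟩
  left_mem_of_isLink := by simp

/-- An embedding of a finite graph `G` in the plane (equivalently, the sphere) with set of faces
`F`, in the usual combinatorial description by a rotation system.

Every edge `e` is split into two darts `(e, false)` and `(e, true)`, its two orientations; the
reverse of a dart `(e, b)` is `(e, !b)`.  `rot` turns a dart into the next dart, in clockwise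
order, with the same initial vertex.  Walking along `d` and then along `rot` of the reverse of
`d`, one keeps the face to the left of `d` on the left; `left d` is that face.  So the face
boundaries are made of orbits of the permutation `d ↦ rot (reverse of d)`, and the edge `e`
separates the faces `left (e, false)` and `left (e, true)` (which may be equal).

That the surface obtained is the sphere is expressed as usual by Euler's formula
`|V| - |E| + |F| = 1 + c`, where `c` is the number of components of `G`.  The boundary of a face
may consist of several closed walks if `G` is disconnected, which is why faces are not defined
to be orbits; it must be possible to go from any face to any other face by crossing edges.
If `G` is connected and has an edge, the number of orbits is at most `|E| - |V| + 2`, so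
the conditions force the faces to be exactly the orbits, and say that the rotation system has genus
zero.  In general they say that each component is embedded with genus zero and that the
components are placed, one after another, in faces of what has been drawn before. -/
structure PlaneEmbedding (G : Graph α β) (F : Type*) where
  /-- The initial vertex of a dart. -/
  init : E(G) × Bool → α
  /-- The two darts of an edge run between its ends, in opposite directions. -/
  isLink_init : ∀ (e : E(G)) (b : Bool), G.IsLink e (init (e, b)) (init (e, !b))
  /-- The next dart in clockwise order around the initial vertex. -/
  rot : Equiv.Perm (E(G) × Bool)
  /-- The darts with a given initial vertex form a single cycle of the rotation. -/
  sameCycle_rot_iff : ∀ d d', rot.SameCycle d d' ↔ init d = init d'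
  /-- The face to the left of a dart. -/
  left : E(G) × Bool → F
  /-- Consecutive darts of a boundary walk have the same face on their left. -/
  left_rot : ∀ e b, left (rot (e, !b)) = left (e, b)
  /-- Any two faces are linked by a sequence of faces in which consecutive ones share an edge. -/
  faces_connected : (ofEnds E(G) left).numComponents = 1
  /-- Euler's formula for the sphere. -/
  euler : V(G).ncard + Nat.card F = E(G).ncard + 1 + G.numComponents

/-- The dual graph of an embedded graph: its vertices are the faces, and each edge `e` of `G` is
also an edge of the dual, where it joins the faces on the two sides of `e`. -/
def PlaneEmbedding.dual {G : Graph α β} {F : Type*} (P : G.PlaneEmbedding F) : Graph F β :=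
  ofEnds E(G) P.left

end Graph

/-! ### Matroid automorphisms and duality -/

namespace Matroid

variable {β : Type*}

/-! The fixing number depends only on the automorphism group as a permutation group of the ground
set. Circuits and independent sets determine each other, and a permutation preserving a matroid
preserves its dual, so `M` and `M✶` have the same automorphisms, hence the same fixing sets
(`fixingNumber_dual`). It remains to show `M(G*) = M(G)✶` (`cycleMatroid_dual`).

This is linear algebra over `ZMod 2`. A set is dependent in `M(G*)` iff it contains the support of a
nonzero vector of the cycle space of `G*`, and dependent in `M(G)✶` iff it contains the support of a
nonzero vector of the cut space of `G`, the range of the incidence matrix. These two spaces coincide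
(`exists_incMat_mulVec_eq_iff`): the rotation system shows that cuts lie in the cycle space of `G*`,
and Euler's formula says that the dimensions agree. Connectedness of `G` plays no role, since
Euler's formula counts the components. -/

theorem isAutomorphism_iff_indep {M : Matroid β} {φ : Equiv.Perm M.E} :
    M.IsAutomorphism φ ↔
      ∀ I : Set M.E, M.Indep (Subtype.val '' (φ '' I)) ↔ M.Indep (Subtype.val '' I) := by
  have hground : ∀ X : Set M.E, Subtype.val '' X ⊆ M.E := by
    rintro X _ ⟨x, -, rfl⟩
    exact x.2
  constructor
  · intro h I
    simp only [indep_iff_forall_subset_not_isCircuit (hground _), Set.forall_subset_image_iff]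
    exact forall₂_congr fun C _ ↦ not_congr (h C)
  · intro h C
    simp only [isCircuit_iff_minimal_not_indep (hground _), Set.minimal_iff_forall_ssubset,
      Set.ssubset_iff_subset_ne, ne_eq, not_not, and_imp, Set.forall_subset_image_iff, h,
      Set.image_eq_image Subtype.val_injective, Set.image_eq_image φ.injective]

/-- As an equality of matroids on the type `M.E`, invariance under `φ` can be dualized on both
sides. -/
theorem isAutomorphism_iff_mapEquiv {M : Matroid β} {φ : Equiv.Perm M.E} :
    M.IsAutomorphism φ ↔ (M.restrictSubtype M.E).mapEquiv φ = M.restrictSubtype M.E := by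
  rw [isAutomorphism_iff_indep, ext_iff_indep]
  simp only [mapEquiv_ground_eq, restrictSubtype_ground, Set.image_univ, EquivLike.range_eq_univ,
    Set.subset_univ, forall_const, true_and, mapEquiv_indep_iff, restrictSubtype_indep_iff]
  constructor
  · intro h I
    rw [← h, Equiv.image_symm_image]
  · intro h I
    rw [← h, Equiv.symm_image_image]

theorem IsAutomorphism.dual {M : Matroid β} {φ : Equiv.Perm M.E} (h : M.IsAutomorphism φ) :
    M✶.IsAutomorphism φ := by
  rw [isAutomorphism_iff_mapEquiv] at h
  refine isAutomorphism_iff_mapEquiv.2 ?_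
  -- The ground set of `M✶` is that of `M` by definition. Taking the dual commutes with passing to
  -- the type `M.E` and with mapping along `φ`.
  change (M✶.restrictSubtype M.E).mapEquiv φ = M✶.restrictSubtype M.E
  rw [mapEquiv_eq_map] at h ⊢
  rw [← restrictSubtype_dual]
  exact map_dual.symm.trans (congrArg Matroid.dual h)

theorem isAutomorphism_dual_iff {M : Matroid β} {φ : Equiv.Perm M.E} :
    M✶.IsAutomorphism φ ↔ M.IsAutomorphism φ := by
  refine ⟨fun h ↦ ?_, IsAutomorphism.dual⟩
  have h' := isAutomorphism_iff_indep.1 (IsAutomorphism.dual (M := M✶) h)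
  refine isAutomorphism_iff_indep.2 fun I ↦ ?_
  -- The type of `φ` involves the ground set, so `M✶✶ = M` is used only inside statements about
  -- independence.
  have hd : ∀ X, M✶✶.Indep X ↔ M.Indep X := fun X ↦ by rw [dual_dual]
  exact (hd _).symm.trans ((h' I).trans (hd _))

theorem fixingNumber_dual (M : Matroid β) : M✶.fixingNumber = M.fixingNumber := by
  have h : ∀ S : Set M✶.E, M✶.IsFixingSet S ↔ M.IsFixingSet S := fun S ↦
    forall_congr' fun φ ↦ imp_congr_left isAutomorphism_dual_iff
  unfold fixingNumber
  congr 1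
  ext r
  exact exists_congr fun S ↦ and_congr_right fun _ ↦ h S

end Matroid

/-! ### Cycle space and cut space over `ZMod 2` -/

namespace Graph

variable {α β : Type*}

/-- The mod 2 incidence matrix of `G`, with rows indexed by edges and columns by vertices. -/
noncomputable def incMat (G : Graph α β) : Matrix E(G) V(G) (ZMod 2) :=
  Matrix.of fun e v ↦ G.incVec e v

theorem incVec_apply_eq_zero {G : Graph α β} (e : β) {x : α} (hx : x ∉ V(G)) :
    G.incVec e x = 0 := by
  rw [incVec, if_neg]
  rintro ⟨y, -, h⟩
  exact hx h.left_mem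

-- The matrix sends a 0-1 labelling of the vertices to the set of edges whose ends have different
-- labels; loops get 0. Its range is therefore the cut space.
open Classical in
theorem IsLink.incMat_mulVec {G : Graph α β} [Fintype V(G)] {e : E(G)} {u v : V(G)}
    (h : G.IsLink e u v) (x : V(G) → ZMod 2) : (G.incMat.mulVec x) e = x u + x v := by
  have : ∀ w : V(G), G.incVec e w * x w =
      (if w = u then x w else 0) + (if w = v then x w else 0) := by
    intro w
    rw [h.incVec_eq]
    simp only [Pi.add_apply, Pi.single_apply, Subtype.val_inj, add_mul, ite_mul, one_mul, zero_mul]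
  simp [Matrix.mulVec, dotProduct, incMat, this, Finset.sum_add_distrib]

theorem incMat_mulVec_eq_zero_iff {G : Graph α β} [Fintype V(G)] {x : V(G) → ZMod 2} :
    G.incMat.mulVec x = 0 ↔ ∀ u v : V(G), G.Adj u v → x u = x v := by
  constructor
  · rintro h u v ⟨e, he⟩
    have := congrFun h ⟨e, he.edge_mem⟩
    rwa [IsLink.incMat_mulVec (e := ⟨e, he.edge_mem⟩) he, Pi.zero_apply,
      CharTwo.add_eq_zero] at this
  · intro h
    ext ⟨e, he⟩
    obtain ⟨u, v, huv⟩ := G.exists_isLink_of_mem_edgeSet he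
    rw [IsLink.incMat_mulVec (u := ⟨u, huv.left_mem⟩) (v := ⟨v, huv.right_mem⟩) huv,
      h ⟨u, huv.left_mem⟩ ⟨v, huv.right_mem⟩ ⟨e, huv⟩]
    exact CharTwo.add_self_eq_zero _

/-- The rank of the incidence matrix is the number of vertices minus the number of components. -/
theorem rank_incMat_add_numComponents (G : Graph α β) [Fintype V(G)] [Fintype E(G)] :
    G.incMat.rank + G.numComponents = Fintype.card V(G) := by
  classical
  let r : V(G) → V(G) → Prop := fun x y ↦ G.Adj x y
  have : Fintype (Quot r) := Fintype.ofFinite _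
  -- The kernel consists of the labellings constant on components, that is, the functions on the
  -- quotient; rank-nullity then gives the count.
  have hker : LinearMap.range (LinearMap.funLeft (ZMod 2) (ZMod 2) (Quot.mk r)) =
      LinearMap.ker G.incMat.mulVecLin := by
    ext x
    rw [LinearMap.mem_ker, Matrix.mulVecLin_apply, incMat_mulVec_eq_zero_iff]
    constructor
    · rintro ⟨g, rfl⟩ u v huv
      exact congrArg g (Quot.sound huv)
    · intro h
      exact ⟨Quot.lift x h, rfl⟩
  have hinj : Function.Injective (LinearMap.funLeft (ZMod 2) (ZMod 2) (Quot.mk r)) :=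
    LinearMap.funLeft_injective_of_surjective _ _ _ Quot.mk_surjective
  have h1 := LinearMap.finrank_range_add_finrank_ker G.incMat.mulVecLin
  rw [← hker, LinearMap.finrank_range_of_inj hinj, Module.finrank_fintype_fun_eq_card,
    Module.finrank_fintype_fun_eq_card, ← Nat.card_eq_fintype_card] at h1
  exact h1

/-- The vectors in the kernel of the transposed incidence matrix are the cycle space of `G`. -/
theorem transpose_incMat_mulVec_eq_zero_iff {G : Graph α β} [Fintype E(G)] (c : E(G) → ZMod 2) :
    G.incMat.transpose.mulVec c = 0 ↔ ∑ e, c e • G.incVec e = 0 := by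
  have h : ∀ v : V(G), (G.incMat.transpose.mulVec c) v = (∑ e, c e • G.incVec e) v := by
    intro v
    simp [Matrix.mulVec, dotProduct, incMat, mul_comm]
  constructor
  · intro h0
    ext x
    -- `incVec` is a function on all of `α`, while the matrix only has columns for `V(G)`; the
    -- remaining coordinates vanish.
    by_cases hx : x ∈ V(G)
    · exact (h ⟨x, hx⟩).symm.trans (congrFun h0 _)
    · simp [incVec_apply_eq_zero _ hx]
  · intro h0
    ext v
    rw [h, h0]
    rfl

/-- An edge set is dependent in the cycle matroid if and only if it contains the support of a
nonzero element of the cycle space. -/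
theorem not_isAcyclicSet_iff_sum_smul_incVec {G : Graph α β} [Fintype E(G)] {I : Set β}
    (hI : I ⊆ E(G)) :
    ¬ G.IsAcyclicSet I ↔
      ∃ c : E(G) → ZMod 2, c ≠ 0 ∧ (∀ e, c e ≠ 0 → (e : β) ∈ I) ∧
        ∑ e, c e • G.incVec e = 0 := by
  classical
  rw [isAcyclicSet_iff_linearIndepOn hI, not_linearIndepOn_incVec_iff]
  -- The only nonzero scalar is 1, so coefficient vectors and finite edge sets correspond through
  -- support and indicator.
  have h1 : ∀ z : ZMod 2, z ≠ 0 → z = 1 := by decide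
  constructor
  · rintro ⟨T, hTI, ⟨e, he⟩, hT⟩
    refine ⟨fun e ↦ if (e : β) ∈ T then 1 else 0, fun h ↦ ?_, fun e he ↦ hTI (by simpa using he),
      ?_⟩
    · simpa [he] using congrFun h ⟨e, hI (hTI he)⟩
    · simp only [ite_smul, one_smul, zero_smul]
      rw [← Finset.sum_filter, ← hT]
      exact Finset.sum_bij (fun e _ ↦ e) (by simp) (fun _ _ _ _ ↦ Subtype.ext)
        (fun e he ↦ ⟨⟨e, hI (hTI he)⟩, by simpa using he, rfl⟩) (fun _ _ ↦ rfl)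
  · rintro ⟨c, hc, hcI, h0⟩
    refine ⟨(Finset.univ.filter (fun e ↦ c e ≠ 0)).map (Function.Embedding.subtype _), ?_, ?_, ?_⟩
    · intro e he
      simp only [Finset.coe_map, Set.mem_image, Finset.mem_coe, Finset.mem_filter] at he
      obtain ⟨e, ⟨-, he⟩, rfl⟩ := he
      exact hcI e he
    · obtain ⟨e, he⟩ := Function.ne_iff.1 hc
      exact ⟨e, by simpa using he⟩
    · rw [Finset.sum_map, Finset.sum_filter]
      refine Eq.trans ?_ h0
      refine Finset.sum_congr rfl fun e _ ↦ ?_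
      split_ifs with h
      · rw [h1 _ h, one_smul]
        rfl
      · rw [not_not.1 h, zero_smul]

/-- An edge set meets every base of the cycle matroid if and only if it contains the support of a
nonzero element of the cut space. -/
theorem dual_cycleMatroid_not_indep_iff {G : Graph α β} [Fintype V(G)] {I : Set β}
    (hI : I ⊆ E(G)) :
    ¬ G.cycleMatroid✶.Indep I ↔
      ∃ c : E(G) → ZMod 2, c ≠ 0 ∧ (∀ e, c e ≠ 0 → (e : β) ∈ I) ∧
        ∃ x, G.incMat.mulVec x = c := by
  classical
  rw [Matroid.dual_indep_iff_exists hI]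
  constructor
  · intro h
    obtain ⟨J, hJ⟩ := G.cycleMatroid.exists_isBasis (E(G) \ I) Set.sdiff_subset
    -- `J` is a maximal independent set off `I`. If its rows spanned every row, it would be a base
    -- avoiding `I`.
    obtain ⟨e, heE, he⟩ : ∃ e ∈ E(G), G.incVec e ∉ Submodule.span (ZMod 2) (G.incVec '' J) := by
      by_contra! hcon
      refine h ⟨J, ?_, Set.disjoint_right.2 fun e he ↦ (hJ.subset he).2⟩
      refine hJ.indep.isBase_of_forall_insert fun e he hins ↦ ?_
      rw [cycleMatroid_indep_iff, isAcyclicSet_iff_linearIndepOn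
        (Set.insert_subset he.1 hJ.indep.subset_ground)] at hins
      exact ((linearIndepOn_insert he.2).1 hins).2 (hcon e he.1)
    -- A functional vanishing on the span of `J` but not at `e`, read as a vertex labelling, gives
    -- the cut. By maximality of `J`, every row off `I` lies in this span, so the cut is supported
    -- in `I`.
    obtain ⟨f, hfe, hf⟩ := Submodule.exists_le_ker_of_notMem he
    have hmul : ∀ e : E(G), (G.incMat.mulVec fun v ↦ f (Pi.single v 1)) e = f (G.incVec e) := by
      rintro ⟨e, he⟩
      obtain ⟨u, v, huv⟩ := G.exists_isLink_of_mem_edgeSet he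
      rw [IsLink.incMat_mulVec (u := ⟨u, huv.left_mem⟩) (v := ⟨v, huv.right_mem⟩) huv,
        huv.incVec_eq, map_add]
    refine ⟨G.incMat.mulVec fun v ↦ f (Pi.single v 1), fun h0 ↦ ?_, fun e' he' ↦ ?_, _, rfl⟩
    · exact hfe (by rw [← hmul ⟨e, heE⟩, h0]; rfl)
    · by_contra heI
      rw [hmul] at he'
      refine he' (hf ?_)
      by_contra hns
      have heJ : (e' : β) ∉ J := fun hJ' ↦ hns (Submodule.subset_span ⟨_, hJ', rfl⟩)
      refine heJ (hJ.mem_of_insert_indep ⟨e'.2, heI⟩ ?_)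
      have hsub : insert (e' : β) J ⊆ E(G) :=
        Set.insert_subset e'.2 hJ.indep.subset_ground
      rw [cycleMatroid_indep_iff, isAcyclicSet_iff_linearIndepOn hsub]
      exact ((isAcyclicSet_iff_linearIndepOn hJ.indep.subset_ground).1 hJ.indep).insert hns
  · rintro ⟨_, hc, hcI, x, rfl⟩ ⟨B, hB, hdisj⟩
    -- Conversely, the labelling `x` gives a functional on rows with values `c`. It vanishes on a
    -- base `B` disjoint from `I`, and the rows of `B` span all rows, so `c = 0`.
    let f : (α → ZMod 2) →ₗ[ZMod 2] ZMod 2 := ∑ v : V(G), x v • LinearMap.proj (v : α)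
    have hf : ∀ e : E(G), f (G.incVec e) = G.incMat.mulVec x e := by
      intro e
      simp [f, Matrix.mulVec, dotProduct, incMat, mul_comm]
    have hspan : Submodule.span (ZMod 2) (G.incVec '' B) ≤ LinearMap.ker f := by
      rw [Submodule.span_le]
      rintro _ ⟨e, he, rfl⟩
      have heE := hB.subset_ground he
      refine LinearMap.mem_ker.2 ?_
      rw [hf ⟨e, heE⟩]
      by_contra hne
      exact Set.disjoint_left.1 hdisj (hcI _ hne) he
    refine hc (funext fun e ↦ ?_)
    rw [← hf]
    refine hspan ?_
    by_contra hns
    have heB : (e : β) ∉ B := fun h ↦ hns (Submodule.subset_span ⟨_, h, rfl⟩)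
    refine heB (hB.mem_of_insert_indep ?_)
    rw [cycleMatroid_indep_iff, isAcyclicSet_iff_linearIndepOn
      (Set.insert_subset e.2 hB.subset_ground)]
    exact ((isAcyclicSet_iff_linearIndepOn hB.subset_ground).1 hB.indep).insert hns

/-- If finitely many edges are present and there is only one component, the vertex set is
finite. -/
theorem finite_of_numComponents_ofEnds_eq_one {F : Type*} {E : Set β} (hE : E.Finite)
    {ends : E × Bool → F} (h : (ofEnds E ends).numComponents = 1) : Finite F := by
  have := hE.to_subtype
  by_cases hs : Function.Surjective ends
  · exact Finite.of_surjective ends hs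
  obtain ⟨f, hf⟩ := not_forall.1 hs
  -- A vertex `f` that is no end of an edge is isolated, so being equal to `f` is constant on
  -- components, of which there is only one.
  have : Subsingleton F := by
    refine subsingleton_of_forall_eq f fun g ↦ ?_
    have hsub := (Nat.card_eq_one_iff_unique.1 h).1
    have heq := congrArg (Quot.lift
      (fun x : V(ofEnds E ends) ↦ (x : F) = f) ?_) (hsub.elim (Quot.mk _ ⟨f, trivial⟩)
        (Quot.mk _ ⟨g, trivial⟩))
    · simpa using heq
    · rintro x y ⟨e, he, b, hx, hy⟩
      exact propext ⟨fun h ↦ (hf ⟨_, hx.trans h⟩).elim, fun h ↦ (hf ⟨_, hy.trans h⟩).elim⟩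
  infer_instance

/-! ### Plane duality: cuts of `G` are cycles of the dual -/

namespace PlaneEmbedding

variable {F : Type*} {G : Graph α β}

open Classical in
/-- The boundary of every face is in the cycle space. -/
theorem sum_incVec_mul_incVec_dual (P : G.PlaneEmbedding F) [Fintype E(G)] (v : α) (f : F) :
    ∑ e : E(G), G.incVec e v * P.dual.incVec e f = 0 := by
  have hG : ∀ e : E(G), G.incVec e v = ∑ b, if P.init (e, b) = v then (1 : ZMod 2) else 0 := by
    intro e
    rw [(P.isLink_init e true).incVec_eq, Fintype.sum_bool]
    simp [Pi.single_apply, eq_comm]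
  have hD : ∀ (e : E(G)) (b : Bool), P.dual.incVec e f =
      (if P.left (e, b) = f then 1 else 0) + (if P.left (e, !b) = f then 1 else 0) := by
    intro e b
    have hl : P.dual.IsLink e (P.left (e, b)) (P.left (e, !b)) := ⟨e.2, b, rfl, rfl⟩
    rw [hl.incVec_eq]
    simp [Pi.single_apply, eq_comm]
  -- The face to the right of a dart is the face to the left of the next dart around its initial
  -- vertex.
  have hleft : ∀ d : E(G) × Bool, P.left (d.1, !d.2) = P.left (P.rot d) := by
    rintro ⟨e, b⟩
    simpa using (P.left_rot e (!b)).symm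
  have hinit : ∀ d, P.init (P.rot d) = P.init d := fun d ↦
    ((P.sameCycle_rot_iff _ _).1 (Equiv.Perm.sameCycle_apply_right.2 (.refl _ d))).symm
  -- `a` marks the corners of `f` at `v`. A dart from `v` contributes its own corner and that of its
  -- successor under `rot`; as `rot` permutes the darts, each corner is counted twice.
  let a : E(G) × Bool → ZMod 2 := fun d ↦ if P.init d = v ∧ P.left d = f then 1 else 0
  have key : ∀ e : E(G), G.incVec e v * P.dual.incVec e f =
      ∑ b, (a (e, b) + a (P.rot (e, b))) := by
    intro e
    rw [hG, Finset.sum_mul]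
    refine Finset.sum_congr rfl fun b _ ↦ ?_
    rw [hD e b, hleft (e, b)]
    simp only [a, hinit]
    by_cases h : P.init (e, b) = v <;> simp [h]
  simp only [key]
  rw [← Fintype.sum_prod_type' fun e b ↦ a (e, b) + a (P.rot (e, b))]
  simp only [Prod.mk.eta, Finset.sum_add_distrib]
  rw [Equiv.sum_comp P.rot a]
  exact CharTwo.add_self_eq_zero _

/-- The cut space of `G` is the cycle space of the dual graph. -/
theorem exists_incMat_mulVec_eq_iff (P : G.PlaneEmbedding F) [Fintype V(G)] [Fintype E(G)]
    (c : E(G) → ZMod 2) :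
    (∃ x, G.incMat.mulVec x = c) ↔ ∑ e, c e • P.dual.incVec (e : β) = 0 := by
  classical
  have : Finite F := finite_of_numComponents_ofEnds_eq_one (Set.toFinite E(G)) P.faces_connected
  have : Fintype F := Fintype.ofFinite F
  have : Fintype V(P.dual) := inferInstanceAs (Fintype (Set.univ : Set F))
  let _ : Fintype E(P.dual) := ‹Fintype E(G)›
  let D : Matrix E(G) V(P.dual) (ZMod 2) := P.dual.incMat
  have hD : D.transpose.mulVec c = 0 ↔ ∑ e, c e • P.dual.incVec (e : β) = 0 := by
    exact transpose_incMat_mulVec_eq_zero_iff (G := P.dual) c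
  rw [← hD]
  have hle : LinearMap.range G.incMat.mulVecLin ≤ LinearMap.ker D.transpose.mulVecLin := by
    rintro _ ⟨x, rfl⟩
    rw [LinearMap.mem_ker, Matrix.mulVecLin_apply, Matrix.mulVecLin_apply, Matrix.mulVec_mulVec]
    have h0 : D.transpose * G.incMat = 0 := by
      ext f v
      rw [Matrix.mul_apply, Matrix.zero_apply, ← P.sum_incVec_mul_incVec_dual v f]
      exact Finset.sum_congr rfl fun e _ ↦ mul_comm _ _
    rw [h0, Matrix.zero_mulVec]
  -- The range has dimension `|V| - c` and the kernel `|E| - (|F| - 1)`; Euler's formula makes these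
  -- equal, so the inclusion is an equality.
  have h1 := G.rank_incMat_add_numComponents
  have h2 : D.rank + 1 = Fintype.card F := by
    have := P.dual.rank_incMat_add_numComponents
    rw [show P.dual.numComponents = 1 from P.faces_connected] at this
    exact this.trans (Fintype.card_congr (Equiv.Set.univ F))
  have h3 := LinearMap.finrank_range_add_finrank_ker D.transpose.mulVecLin
  change D.transpose.rank + _ = _ at h3
  rw [Matrix.rank_transpose, Module.finrank_fintype_fun_eq_card] at h3
  have h4 := P.euler
  rw [← Nat.card_coe_set_eq, ← Nat.card_coe_set_eq] at h4
  simp only [Nat.card_eq_fintype_card] at h4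
  have heq := Submodule.eq_of_le_of_finrank_eq hle (by
    change G.incMat.rank = _
    omega)
  rw [← Matrix.mulVecLin_apply, ← LinearMap.mem_ker, ← heq]
  rfl

/-- The cycle matroid of the dual graph is the dual of the cycle matroid. -/
theorem cycleMatroid_dual (P : G.PlaneEmbedding F) (hV : V(G).Finite) (hE : E(G).Finite) :
    P.dual.cycleMatroid = G.cycleMatroid✶ := by
  have : Fintype V(G) := hV.fintype
  let iE : Fintype E(G) := hE.fintype
  let _ : Fintype E(P.dual) := iE
  refine Matroid.ext_indep rfl fun I hI ↦ not_iff_not.1 ?_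
  rw [dual_cycleMatroid_not_indep_iff (G := G) hI]
  simp only [P.exists_incMat_mulVec_eq_iff]
  exact not_isAcyclicSet_iff_sum_smul_incVec hI

end PlaneEmbedding

end Graph

theorem proposition4p2 {α β F : Type*} (G : Graph α β) (hV : G.vertexSet.Finite)
    (hE : G.edgeSet.Finite) (P : G.PlaneEmbedding F) :
    G.cycleMatroid.fixingNumber = P.dual.cycleMatroid.fixingNumber := by
  rw [P.cycleMatroid_dual hV hE, Matroid.fixingNumber_dual]
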